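/- **Conventions.** Put $\mathbf{L}^1=\mathbf{L}$ and $\mathbf{L}^\partial=\mathbf{L}^{\mathrm{op}}$ for a bounded lattice $\mathbf L$. An operation $f:L^n\to L$ is a *normal lattice operator of distribution type* $(j_1,\dots,j_n;j_{n+1})\in\{1,\partial\}^{n+1}$ if, as a map $\mathbf{L}^{j_1}\times\cdots\times\mathbf{L}^{j_n}\to\mathbf{L}^{j_{n+1}}$, it distributes over finite joins (including the empty one) in each argument place. A *normal lattice expansion* $\mathbf{L}=(L,\le,\wedge,\vee,0,1,(f_j)_{j\in J})$ is a bounded lattice with a normal lattice operator $f_j$ of distribution type $\delta(j)=(j_1,\dots,j_{n(j)};j_{n(j)+1})$ for each $j\in J$. An *implicative modal lattice* is a bounded lattice with operations $\to,\Box,\Diamond$ satisfying $(a\vee b)\to c=(a\to c)\wedge(b\to c)$, $a\to(b\wedge c)=(a\to b)\wedge(a\to c)$, $(0\to a)=1=(a\to 1)$, $\Box(a\wedge b)=\Box a\wedge\Box b$, $\Box1=1$, $\Diamond(a\vee b)=\Diamond a\vee\Diamond b$, $\Diamond0=0$; it is a normal lattice expansion with $\delta(\to)=(1,\partial;\partial)$,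 $\delta(\Box)=(\partial;\partial)$, $\delta(\Diamond)=(1;1)$. *Frames.* A frame $\mathfrak F=(Z_1,Z_\partial,I,(R_j)_{j\in J})$ has nonempty sorts $Z_1,Z_\partial$, a relation $I\subseteq Z_1\times Z_\partial$ and relations $R_j\subseteq Z_{j_{n(j)+1}}\times\prod_{k=1}^{n(j)}Z_{j_k}$. Let $\perp$ be the complement of $I$ and let $U'$ be the polar with respect to $\perp$ of a subset $U$ of $Z_1$ or of $Z_\partial$. A set with $U=U''$ is called a Galois set; $\mathcal G(Z_1)$ is the complete lattice (under inclusion) of Galois sets contained in $Z_1$ (stable sets). For points $u,w$ of the same sort, $u\preceq w$ iff $\{u\}'\subseteq\{w\}'$, and $\Gamma u=\{w: u\preceq w\}$; sets of the form $\Gamma u$ are the *closed elements*. The frame is *separated* if $\preceq$ is antisymmetric on both sorts. The Galois dual of $R_j$ is given by $R_j'\vec u=(R_j\vec u)'$, where $R_j\vec u=\{w: wR_j\vec u\}$; $R_j$ is *smooth* if every section of $R'_j$ (all arguments but one fixed, in any of the $n(j)+1$ places) is a Galois set. The *full complex algebra* $\mathfrak F^+$ is $\mathcal G(Z_1)$ with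 the operations $\overline F^1_j$ defined as follows: for stable $A_1,\dots,A_{n(j)}$ let $W_k=A_k$ if $j_k=1$, $W_k=A_k'$ if $j_k=\partial$, and $V=\bigcup\{R_j\vec w: w_k\in W_k \text{ for all } k\}$; then $\overline F^1_j(\vec A)=V''$ if $j_{n(j)+1}=1$, and $\overline F^1_j(\vec A)=(V'')'$ if $j_{n(j)+1}=\partial$. *Canonical extensions.* A canonical extension of a bounded lattice $\mathbf L$ is a bounded lattice embedding $\alpha:\mathbf L\to\mathbf C$ into a complete lattice such that every element of $\mathbf C$ is both a meet of joins and a join of meets of elements of $\alpha[L]$ (density) and, calling meets of subsets of $\alpha[L]$ *closed* and joins of subsets of $\alpha[L]$ *open*, for every set $A$ of closed and every set $B$ of open elements, $\bigwedge A\le\bigvee B$ iff $\bigwedge A_1\le\bigvee B_1$ for some finite $A_1\subseteq A$, $B_1\subseteq B$ (compactness). For $f:L^n\to L$ and $u\in C^n$ put $$f^\sigma(u)=\bigvee_{k\le u\le o}\ \bigwedge\{\alpha(f(a)): a\in L^n,\ k\le\alpha(a)\le o\},\qquad f^\pi(u)=\bigwedge_{k\le u\le o}\ \bigvee\{\alpha(f(a)):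 a\in L^n,\ k\le\alpha(a)\le o\},$$ where $k$ ranges over $n$-tuples of closed elements, $o$ over $n$-tuples of open elements, and tuples are ordered (and $\alpha$ applied) coordinatewise. A *canonical extension of a normal lattice expansion* is a canonical extension $(\alpha,\mathbf C)$ of its underlying bounded lattice together with normal lattice operators $F_j$ on $\mathbf C$ of the same distribution types as the $f_j$ that extend the $f_j$ (i.e. $F_j\circ\alpha=\alpha\circ f_j$), such that $F_j=f_j^\sigma$ if $j_{n(j)+1}=1$ and $F_j=f_j^\pi$ if $j_{n(j)+1}=\partial$. **Theorem (Realizing Distribution Types).** (1) Let $\mathbf L$ be a normal lattice expansion. Define its dual frame $\mathbf L_+$ by letting $Z_1$ and $Z_\partial$ be the sets of nonempty (not necessarily proper) lattice filters and ideals of $\mathbf L$, respectively, $xIy$ iff $x\cap y=\emptyset$, and, for each $j\in J$, $$wR_j\vec u\quad\text{iff}\quad \forall a_1,\dots,a_{n(j)}\in L\ \Bigl(\bigwedge_{k=1}^{n(j)}a_k\in u_k\ \Rightarrow\ f_j(a_1,\dots,a_{n(j)})\in w\Bigr),$$ where $u_k\in Z_{j_k}$ and $w\in Z_{j_{n(j)+1}}$.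 Then $\mathbf L_+$ is separated, all its relations $R_j$ are smooth, and its full complex algebra $(\mathbf L_+)^+$, with the embedding $a\mapsto\{x\in Z_1: a\in x\}$, is a canonical extension of the normal lattice expansion $\mathbf L$; in particular, $\overline F^1_j$ is the $\sigma$-extension of $f_j$ if $j_{n(j)+1}=1$, and its $\pi$-extension if $j_{n(j)+1}=\partial$. (2) If $\mathbf L$ is an implicative modal lattice, its dual frame is moreover a *refined frame*. That is, writing $R_\Box$ for the relation of $\Box$ and $\Box_{\mathcal G}=\overline F^1_\Box$ for the operation that it generates on stable sets, and setting $R'_\Box y=(R_\Box y)'$ for $y\in Z_\partial$ and $zR''_\Box=(\{y\in Z_\partial: zR'_\Box y\})'\subseteq Z_1$ for $z\in Z_1$: - (F1) the frame is separated; - (F2) each of its three relations is increasing (with respect to $\preceq$) in the first and decreasing in every other argument place; - (F3) for each relation $R_j$ and each tuple $\vec p$ of the proper sort, $R_j\vec p$ is a closed element; - (F4) each relation is smooth; - (F5) for each $x\in Z_1$, the set $\{z\in Z_1: zR''_\Box\subseteq\Gamma x\}$ is a closed element; - (F6) for every stable set $A$, $\Box_{\mathcal G}\bigl(\bigvee_{x\in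 A}\Gamma x\bigr)\subseteq\bigvee_{x\in A}\Box_{\mathcal G}(\Gamma x)$, joins being taken in $\mathcal G(Z_1)$. -/

import Mathlib

universe u v w

/-- The two-element set of sorts `{1, ∂}`. -/
inductive Sgn : Type
  | one : Sgn
  | del : Sgn

/-- The other sort. -/
def Sgn.flip : Sgn → Sgn
  | Sgn.one => Sgn.del
  | Sgn.del => Sgn.one

/-- A distribution type `(j₁, …, jₙ; jₙ₊₁)`; the same data is the sort `(jₙ₊₁; j₁ ⋯ jₙ)`
of a frame relation. -/
structure DistType : Type where
  arity : ℕ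
  inp : Fin arity → Sgn
  out : Sgn

section Algebra

/-- The binary join of `L¹ = L` or of `L^∂ = Lᵒᵖ`, as an operation on `L`. -/
def signedSup {L : Type u} [Lattice L] : Sgn → L → L → L
  | Sgn.one => fun a b => a ⊔ b
  | Sgn.del => fun a b => a ⊓ b

/-- The empty join (bottom element) of `L¹ = L` or of `L^∂ = Lᵒᵖ`, as an element of `L`. -/
def signedBot {L : Type u} [Lattice L] [BoundedOrder L] : Sgn → L
  | Sgn.one => ⊥
  | Sgn.del => ⊤

/-- `f` is a normal lattice operator of distribution type `δ = (j₁, …, jₙ; jₙ₊₁)`: as a map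
`L^{j₁} × ⋯ × L^{jₙ} → L^{jₙ₊₁}` it distributes over finite (binary and empty) joins in each
argument place. -/
structure IsNormalOp {L : Type u} [Lattice L] [BoundedOrder L] (δ : DistType)
    (f : (Fin δ.arity → L) → L) : Prop where
  additive : ∀ (k : Fin δ.arity) (a : Fin δ.arity → L) (b c : L),
    f (Function.update a k (signedSup (δ.inp k) b c)) =
      signedSup δ.out (f (Function.update a k b)) (f (Function.update a k c))
  normal : ∀ (k : Fin δ.arity) (a : Fin δ.arity → L),
    f (Function.update a k (signedBot (δ.inp k))) = signedBot δ.out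

/-- A normal lattice expansion of similarity type `(δ j)_{j ∈ J}` on the bounded lattice `L`. -/
structure NLE {J : Type v} (δ : J → DistType) (L : Type u) [Lattice L] [BoundedOrder L] where
  op : ∀ j : J, (Fin (δ j).arity → L) → L
  isNormalOp : ∀ j : J, IsNormalOp (δ j) (op j)

/-- Implicative modal lattice structure on the bounded lattice `L`. -/
structure ImplicativeModalLattice (L : Type u) [Lattice L] [BoundedOrder L] where
  imp : L → L → L
  box : L → L
  dia : L → L
  sup_imp : ∀ a b c : L, imp (a ⊔ b) c = imp a c ⊓ imp b c
  imp_inf : ∀ a b c : L, imp a (b ⊓ c) = imp a b ⊓ imp a c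
  bot_imp : ∀ a : L, imp ⊥ a = ⊤
  imp_top : ∀ a : L, imp a ⊤ = ⊤
  box_inf : ∀ a b : L, box (a ⊓ b) = box a ⊓ box b
  box_top : box ⊤ = ⊤
  dia_sup : ∀ a b : L, dia (a ⊔ b) = dia a ⊔ dia b
  dia_bot : dia ⊥ = ⊥

/-- Indices of the operators of an implicative modal lattice. -/
inductive ModalIdx : Type
  | imp : ModalIdx
  | box : ModalIdx
  | dia : ModalIdx

/-- `δ(→) = (1, ∂; ∂)`, `δ(□) = (∂; ∂)`, `δ(◇) = (1; 1)`. -/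
def modalType : ModalIdx → DistType
  | ModalIdx.imp => ⟨2, ![Sgn.one, Sgn.del], Sgn.del⟩
  | ModalIdx.box => ⟨1, fun _ => Sgn.del, Sgn.del⟩
  | ModalIdx.dia => ⟨1, fun _ => Sgn.one, Sgn.one⟩

/-- The operators of an implicative modal lattice as a family indexed by `ModalIdx`. -/
def ImplicativeModalLattice.op {L : Type u} [Lattice L] [BoundedOrder L]
    (M : ImplicativeModalLattice L) :
    ∀ j : ModalIdx, (Fin (modalType j).arity → L) → L
  | ModalIdx.imp => fun (a : Fin 2 → L) => M.imp (a 0) (a 1)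
  | ModalIdx.box => fun (a : Fin 1 → L) => M.box (a 0)
  | ModalIdx.dia => fun (a : Fin 1 → L) => M.dia (a 0)

/-- An implicative modal lattice as a normal lattice expansion. -/
def ImplicativeModalLattice.toNLE {L : Type u} [Lattice L] [BoundedOrder L]
    (M : ImplicativeModalLattice L) : NLE modalType L where
  op := M.op
  isNormalOp := by
    intro j
    cases j with
    | imp =>
      constructor
      · intro k a b c
        change Fin 2 at k
        change Fin 2 → L at a
        fin_cases k
        · exact M.sup_imp b c (a 1)
        · exact M.imp_inf (a 0) b c
      · intro k a
        change Fin 2 at k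
        change Fin 2 → L at a
        fin_cases k
        · exact M.bot_imp (a 1)
        · exact M.imp_top (a 0)
    | box =>
      constructor
      · intro k a b c
        change Fin 1 at k
        fin_cases k
        exact M.box_inf b c
      · intro k a
        change Fin 1 at k
        fin_cases k
        exact M.box_top
    | dia =>
      constructor
      · intro k a b c
        change Fin 1 at k
        fin_cases k
        exact M.dia_sup b c
      · intro k a
        change Fin 1 at k
        fin_cases k
        exact M.dia_bot

end Algebra

section CanonicalExtension

variable {L : Type u} [Lattice L] [BoundedOrder L] {C : Type w} [CompleteLattice C]

/-- Closed elements of a completion: meets of elements of the image. -/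
def IsClosedElt (α : L → C) (c : C) : Prop := ∃ S : Set L, c = sInf (α '' S)

/-- Open elements of a completion: joins of elements of the image. -/
def IsOpenElt (α : L → C) (c : C) : Prop := ∃ S : Set L, c = sSup (α '' S)

/-- `(α, C)` is a canonical extension of the bounded lattice `L`. -/
structure IsCanonicalExtension (α : L → C) : Prop where
  injective : Function.Injective α
  map_sup : ∀ a b : L, α (a ⊔ b) = α a ⊔ α b
  map_inf : ∀ a b : L, α (a ⊓ b) = α a ⊓ α b
  map_bot : α ⊥ = ⊥
  map_top : α ⊤ = ⊤
  /-- every element is a meet of joins of elements of the image -/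
  dense_inf : ∀ c : C, ∃ T : Set C, (∀ o ∈ T, IsOpenElt α o) ∧ c = sInf T
  /-- every element is a join of meets of elements of the image -/
  dense_sup : ∀ c : C, ∃ T : Set C, (∀ k ∈ T, IsClosedElt α k) ∧ c = sSup T
  compact : ∀ A B : Set C, (∀ k ∈ A, IsClosedElt α k) → (∀ o ∈ B, IsOpenElt α o) →
    (sInf A ≤ sSup B ↔
      ∃ A₁ B₁ : Set C, A₁ ⊆ A ∧ B₁ ⊆ B ∧ A₁.Finite ∧ B₁.Finite ∧ sInf A₁ ≤ sSup B₁)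

/-- The σ-extension of an `n`-ary operation on `L` along `α`:
`f^σ(u) = ⋁ { ⋀ { f(a) | a ∈ Lⁿ, k ≤ a ≤ o } | k closed, o open, k ≤ u ≤ o }`. -/
def sigmaExt (α : L → C) {n : ℕ} (f : (Fin n → L) → L) (x : Fin n → C) : C :=
  sSup {c | ∃ k o : Fin n → C, (∀ i, IsClosedElt α (k i)) ∧ (∀ i, IsOpenElt α (o i)) ∧
    k ≤ x ∧ x ≤ o ∧
    c = sInf {d | ∃ a : Fin n → L, (∀ i, k i ≤ α (a i)) ∧ (∀ i, α (a i) ≤ o i) ∧ d = α (f a)}}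

/-- The π-extension of an `n`-ary operation on `L` along `α`:
`f^π(u) = ⋀ { ⋁ { f(a) | a ∈ Lⁿ, k ≤ a ≤ o } | k closed, o open, k ≤ u ≤ o }`. -/
def piExt (α : L → C) {n : ℕ} (f : (Fin n → L) → L) (x : Fin n → C) : C :=
  sInf {c | ∃ k o : Fin n → C, (∀ i, IsClosedElt α (k i)) ∧ (∀ i, IsOpenElt α (o i)) ∧
    k ≤ x ∧ x ≤ o ∧
    c = sSup {d | ∃ a : Fin n → L, (∀ i, k i ≤ α (a i)) ∧ (∀ i, α (a i) ≤ o i) ∧ d = α (f a)}}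

/-- `C`, with the operations `F j` and the map `α`, is a canonical extension of the normal
lattice expansion `A`. -/
structure IsCanonicalExtensionNLE {J : Type v} {δ : J → DistType} (A : NLE δ L)
    (F : ∀ j : J, (Fin (δ j).arity → C) → C) (α : L → C) : Prop where
  lattice : IsCanonicalExtension α
  isNormalOp : ∀ j : J, IsNormalOp (δ j) (F j)
  extends_op : ∀ (j : J) (a : Fin (δ j).arity → L), F j (fun i => α (a i)) = α (A.op j a)
  eq_sigmaExt : ∀ j : J, (δ j).out = Sgn.one → F j = sigmaExt α (A.op j)
  eq_piExt : ∀ j : J, (δ j).out = Sgn.del → F j = piExt α (A.op j)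

end CanonicalExtension

/-- Two-sorted relational structures `(Z₁, Z_∂, I, (R_j)_{j ∈ J})` whose relation `R_j` has the
sort `σ j`, so `R_j ⊆ Z_{jₙ₊₁} × (Z_{j₁} × ⋯ × Z_{jₙ})`. Separation and smoothness are the
predicates `Frame.Separated` and `Frame.Smooth` below. -/
structure Frame {J : Type v} (σ : J → DistType) where
  Z : Sgn → Type u
  nonempty : ∀ s : Sgn, Nonempty (Z s)
  I : Z Sgn.one → Z Sgn.del → Prop
  R : ∀ j : J, Z (σ j).out → (∀ k : Fin (σ j).arity, Z ((σ j).inp k)) → Prop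

namespace Frame

variable {J : Type v} {σ : J → DistType} (F : Frame.{u, v} σ)

/-- The Galois relation (the complement of `I`), read from either sort. -/
def gal : ∀ s : Sgn, F.Z s → F.Z s.flip → Prop
  | Sgn.one => fun x y => ¬ F.I x y
  | Sgn.del => fun y x => ¬ F.I x y

/-- `U'` for a set `U` of points of sort `s`. -/
def up (s : Sgn) (U : Set (F.Z s)) : Set (F.Z s.flip) := {t | ∀ z ∈ U, F.gal s z t}

/-- `V'` for a set `V` of points of the sort other than `s`. -/
def down (s : Sgn) (V : Set (F.Z s.flip)) : Set (F.Z s) := {z | ∀ t ∈ V, F.gal s z t}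

/-- The closure `U''`. -/
def cl (s : Sgn) (U : Set (F.Z s)) : Set (F.Z s) := F.down s (F.up s U)

/-- Galois sets: stable sets for `s = 1`, co-stable sets for `s = ∂`. -/
def IsGalois (s : Sgn) (U : Set (F.Z s)) : Prop := F.cl s U = U

/-- The preorder `u ≼ w` iff `{u}' ⊆ {w}'` on each sort. -/
def le (s : Sgn) (z t : F.Z s) : Prop := F.up s {z} ⊆ F.up s {t}

/-- The closed element `Γ z = {t | z ≼ t}`. -/
def Gam (s : Sgn) (z : F.Z s) : Set (F.Z s) := {t | F.le s z t}

/-- The frame is separated. -/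
def Separated : Prop := ∀ (s : Sgn) (z t : F.Z s), F.le s z t → F.le s t z → z = t

/-- The Galois dual relation: `R'_j p = (R_j p)'`. -/
def Rdual (j : J) (t : F.Z (σ j).out.flip) (p : ∀ k, F.Z ((σ j).inp k)) : Prop :=
  t ∈ F.up (σ j).out {z | F.R j z p}

/-- All frame relations are smooth: every section of each Galois dual relation is a
Galois set. -/
def Smooth : Prop :=
  ∀ j : J,
    (∀ p : ∀ k, F.Z ((σ j).inp k), F.IsGalois (σ j).out.flip {t | F.Rdual j t p}) ∧
    (∀ (k : Fin (σ j).arity) (t : F.Z (σ j).out.flip) (p : ∀ k, F.Z ((σ j).inp k)),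
      F.IsGalois ((σ j).inp k) {z | F.Rdual j t (Function.update p k z)})

theorem subset_cl (s : Sgn) (U : Set (F.Z s)) : U ⊆ F.cl s U :=
  fun _ hz _ ht => ht _ hz

theorem down_up_down (s : Sgn) (V : Set (F.Z s.flip)) :
    F.cl s (F.down s V) = F.down s V :=
  Set.Subset.antisymm (fun _ hz t ht => hz t fun _ hx => hx t ht) (F.subset_cl s _)

theorem cl_cl (s : Sgn) (U : Set (F.Z s)) : F.cl s (F.cl s U) = F.cl s U :=
  F.down_up_down s _

theorem cl_mono (s : Sgn) {U V : Set (F.Z s)} (h : U ⊆ V) : F.cl s U ⊆ F.cl s V :=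
  fun _ hz t ht => hz t fun x hx => ht x (h hx)

theorem isGalois_Gam (s : Sgn) (z : F.Z s) : F.IsGalois s (F.Gam s z) := by
  have h : F.Gam s z = F.down s (F.up s {z}) := by
    ext t
    constructor
    · intro h r hr
      exact h hr t rfl
    · intro h r hr x hx
      rw [Set.mem_singleton_iff] at hx
      subst hx
      exact h r hr
  rw [h]
  exact F.down_up_down s _

/-- The Galois stable sets, `𝒢(Z₁)`. -/
def Stable : Type u := {U : Set (F.Z Sgn.one) // F.IsGalois Sgn.one U}

theorem isGalois_sInter {T : Set (Set (F.Z Sgn.one))} (h : ∀ U ∈ T, F.IsGalois Sgn.one U) :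
    F.IsGalois Sgn.one (⋂₀ T) := by
  refine Set.Subset.antisymm (fun z hz U hU => ?_) (F.subset_cl _ _)
  rw [← h U hU]
  exact F.cl_mono _ (Set.sInter_subset_of_mem hU) hz

theorem isGalois_inter {U V : Set (F.Z Sgn.one)} (hU : F.IsGalois Sgn.one U)
    (hV : F.IsGalois Sgn.one V) : F.IsGalois Sgn.one (U ∩ V) := by
  have h := F.isGalois_sInter (T := {U, V}) (by
    rintro W (rfl | rfl)
    · exact hU
    · exact hV)
  rwa [Set.sInter_pair] at h

theorem cl_subset {U V : Set (F.Z Sgn.one)} (hV : F.IsGalois Sgn.one V) (h : U ⊆ V) :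
    F.cl Sgn.one U ⊆ V := by
  rw [← hV]
  exact F.cl_mono _ h

/-- The complete lattice of stable sets: order is inclusion, meets are intersections, joins are
closures of unions. -/
instance : CompleteLattice F.Stable where
  le A B := A.1 ⊆ B.1
  le_refl A := Set.Subset.refl A.1
  le_trans _ _ _ h₁ h₂ := Set.Subset.trans h₁ h₂
  le_antisymm _ _ h₁ h₂ := Subtype.ext (Set.Subset.antisymm h₁ h₂)
  sup A B := ⟨F.cl Sgn.one (A.1 ∪ B.1), F.cl_cl _ _⟩
  inf A B := ⟨A.1 ∩ B.1, F.isGalois_inter A.2 B.2⟩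
  le_sup_left _ _ := Set.Subset.trans Set.subset_union_left (F.subset_cl _ _)
  le_sup_right _ _ := Set.Subset.trans Set.subset_union_right (F.subset_cl _ _)
  sup_le _ _ C h₁ h₂ := F.cl_subset C.2 (Set.union_subset h₁ h₂)
  inf_le_left _ _ := Set.inter_subset_left
  inf_le_right _ _ := Set.inter_subset_right
  le_inf _ _ _ h₁ h₂ := Set.subset_inter h₁ h₂
  sSup T := ⟨F.cl Sgn.one (⋃₀ (Subtype.val '' T)), F.cl_cl _ _⟩
  sInf T := ⟨⋂₀ (Subtype.val '' T), F.isGalois_sInter (by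
    rintro _ ⟨A, _, rfl⟩
    exact A.2)⟩
  isLUB_sSup T := by
    constructor
    · intro A hA
      exact Set.Subset.trans (Set.subset_sUnion_of_mem (Set.mem_image_of_mem Subtype.val hA)) (F.subset_cl _ _)
    · intro B hB
      refine F.cl_subset B.2 (Set.sUnion_subset ?_)
      rintro _ ⟨A, hA, rfl⟩
      exact hB hA
  isGLB_sInf T := by
    constructor
    · intro A hA
      exact Set.sInter_subset_of_mem (Set.mem_image_of_mem Subtype.val hA)
    · intro B hB
      refine Set.subset_sInter ?_
      rintro _ ⟨A, hA, rfl⟩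
      exact hB hA
  top := ⟨Set.univ, Set.Subset.antisymm (Set.subset_univ _) (F.subset_cl _ _)⟩
  bot := ⟨F.cl Sgn.one ∅, F.cl_cl _ _⟩
  le_top _ := Set.subset_univ _
  bot_le A := F.cl_subset A.2 (Set.empty_subset _)

/-- The sorted image operator generated by `R_j`. -/
def image (j : J) (W : ∀ k, Set (F.Z ((σ j).inp k))) : Set (F.Z (σ j).out) :=
  {z | ∃ p : ∀ k, F.Z ((σ j).inp k), F.R j z p ∧ ∀ k, p k ∈ W k}

/-- A stable set `A` as an argument of sort `s`: `A` for `s = 1` and `A'` for `s = ∂`. -/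
def toSort (A : F.Stable) : ∀ s : Sgn, Set (F.Z s)
  | Sgn.one => A.1
  | Sgn.del => F.up Sgn.one A.1

/-- The stable set given by the closure of `V`, a set of sort `s`: `V''` for `s = 1` and
`(V'')'` for `s = ∂`. -/
def ofSort : ∀ s : Sgn, Set (F.Z s) → F.Stable
  | Sgn.one => fun V => ⟨F.cl Sgn.one V, F.cl_cl Sgn.one V⟩
  | Sgn.del => fun V => ⟨F.down Sgn.one (F.cl Sgn.del V), F.down_up_down Sgn.one (F.cl Sgn.del V)⟩

/-- The operation of the full complex algebra of the frame that is generated by `R_j`: the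
closure of the sorted image operator composed with the Galois connection. The full complex algebra is the
complete lattice `F.Stable` with these operations. -/
def complexOp (j : J) (A : Fin (σ j).arity → F.Stable) : F.Stable :=
  F.ofSort (σ j).out (F.image j (fun k => F.toSort (A k) ((σ j).inp k)))

/-- The closed element `Γ x` as a member of `𝒢(Z₁)`. -/
def GamS (x : F.Z Sgn.one) : F.Stable := ⟨F.Gam Sgn.one x, F.isGalois_Gam _ _⟩

end Frame

section Refined

variable (F : Frame.{u, 0} modalType)

/-- The operator `□` of the full complex algebra on stable sets. -/
def boxOp (A : F.Stable) : F.Stable := F.complexOp ModalIdx.box (fun _ : Fin 1 => A)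

/-- `R'_□ ⊆ Z₁ × Z_∂`, the Galois dual of `R_□`. -/
def boxDual (x : F.Z Sgn.one) (y : F.Z Sgn.del) : Prop :=
  F.Rdual ModalIdx.box x (fun _ => y)

/-- The section `x R''_□ = (x R'_□)'` of the double dual relation `R''_□ ⊆ Z₁ × Z₁`. -/
def boxDoubleDual (x : F.Z Sgn.one) : Set (F.Z Sgn.one) :=
  F.down Sgn.one {y : F.Z Sgn.del | boxDual F x y}

/-- Refined frames. -/
structure IsRefinedFrame : Prop where
  /-- (F1) the frame is separated -/
  separated : F.Separated
  /-- (F2) each relation is increasing in the first place -/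
  increasing : ∀ (j : ModalIdx) (z t : F.Z (modalType j).out)
    (p : ∀ k, F.Z ((modalType j).inp k)), F.le _ z t → F.R j z p → F.R j t p
  /-- (F2) each relation is decreasing in every other place -/
  decreasing : ∀ (j : ModalIdx) (z : F.Z (modalType j).out)
    (p : ∀ k, F.Z ((modalType j).inp k)) (k : Fin (modalType j).arity)
    (t : F.Z ((modalType j).inp k)),
    F.le _ t (p k) → F.R j z p → F.R j z (Function.update p k t)
  /-- (F3) each section `R_j p` is a closed element -/
  closed_section : ∀ (j : ModalIdx) (p : ∀ k, F.Z ((modalType j).inp k)),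
    ∃ t : F.Z (modalType j).out, {z | F.R j z p} = F.Gam _ t
  /-- (F4) each relation is smooth -/
  smooth : F.Smooth
  /-- (F5) each section `{z | z R''_□ ⊆ Γ x}` is a closed element -/
  box_closed : ∀ x : F.Z Sgn.one, ∃ t : F.Z Sgn.one,
    {z | boxDoubleDual F z ⊆ F.Gam Sgn.one x} = F.Gam Sgn.one t
  /-- (F6) restricted join-distributivity of `□` -/
  box_iSup : ∀ A : F.Stable,
    boxOp F (⨆ x ∈ A.1, F.GamS x) ≤ ⨆ x ∈ A.1, boxOp F (F.GamS x)

end Refined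

section Dual

variable {L : Type u} [Lattice L] [BoundedOrder L]

/-- The points of the dual frame: filters for the sort `1`, ideals for the sort `∂`. -/
def dualPoint (L : Type u) [Lattice L] : Sgn → Type u
  | Sgn.one => Order.PFilter L
  | Sgn.del => Order.Ideal L

/-- `a ∈ z` for a filter or ideal `z`. -/
def dualMem (a : L) : ∀ s : Sgn, dualPoint L s → Prop
  | Sgn.one => fun x : Order.PFilter L => a ∈ x
  | Sgn.del => fun y : Order.Ideal L => a ∈ y

/-- The dual frame of a normal lattice expansion. -/
def dualFrame {J : Type v} {δ : J → DistType} (A : NLE δ L) : Frame.{u, v} δ where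
  Z := dualPoint L
  nonempty s := match s with
    | Sgn.one => ⟨(Order.PFilter.principal ⊤ : Order.PFilter L)⟩
    | Sgn.del => ⟨(Order.Ideal.principal ⊥ : Order.Ideal L)⟩
  I := fun (x : Order.PFilter L) (y : Order.Ideal L) => (x : Set L) ∩ (y : Set L) = ∅
  R := fun j z p => ∀ a : Fin (δ j).arity → L,
    (∀ k, dualMem (a k) ((δ j).inp k) (p k)) → dualMem (A.op j a) (δ j).out z

theorem isGalois_filtersContaining {J : Type v} {δ : J → DistType} (A : NLE δ L) (a : L) :
    (dualFrame A).IsGalois Sgn.one {x : Order.PFilter L | a ∈ x} := by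
  refine Set.Subset.antisymm (fun (x : Order.PFilter L) hx => ?_) (Frame.subset_cl _ _ _)
  have h : ¬ ((x : Set L) ∩ ((Order.Ideal.principal a : Order.Ideal L) : Set L) = ∅) := by
    refine hx (Order.Ideal.principal a : Order.Ideal L) ?_
    intro (z : Order.PFilter L) (hz : a ∈ z)
    change ¬ ((z : Set L) ∩ ((Order.Ideal.principal a : Order.Ideal L) : Set L) = ∅)
    rw [← Ne, ← Set.nonempty_iff_ne_empty]
    exact ⟨a, hz, Order.Ideal.mem_principal_self⟩
  rw [← Ne, ← Set.nonempty_iff_ne_empty] at h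
  obtain ⟨b, hb, hba⟩ := h
  exact x.mem_of_le (Order.Ideal.mem_principal.1 hba) hb

/-- The representation map: `a` goes to the set of filters containing `a`. -/
def zeta {J : Type v} {δ : J → DistType} (A : NLE δ L) (a : L) : (dualFrame A).Stable :=
  ⟨{x : Order.PFilter L | a ∈ x}, isGalois_filtersContaining A a⟩

end Dual

/-!
A stable set `B` may be read as `B` in `𝒢(Z₁)` or as `B'` in the order dual, so a fact about
either sort gives its order dual, and the two cases can be treated as one.

A relation is determined by a point operator: `R_j p` is `Γ` of the filter or ideal generated by
`{f_j a | a ∈ p}`. It is smooth because the elements that `f_j`, with members of `p` in its other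
places, can send into a given ideal or filter themselves form a filter or ideal, the residual, so
that each section of `R'_j` is the polar of a single point. Smoothness in turn allows a closure to
be dropped in each argument of the image operator, whence the operation `F_j` of the complex algebra
distributes over joins.

The closed and open elements of the representation `ζ` are exactly the stable sets generated by a
filter and by an ideal, and `Γ x ⊆ {y}'` holds iff `x` and `y` meet. Compactness follows, and also
the formula for the extensions: `F_j` is the join, in `𝒢(Z₁)` or in its dual, of the stable sets
generated by the values of the point operator, and a tuple of points below the arguments can be
traded for an interval `k ≤ ζ a ≤ o` around them, an element common to the filter of `k` and the
ideal of `o` providing the bounds.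

For a modal lattice, `x ∈ □B` iff `□⁻¹x ∈ B`, and `x R''_□ = Γ (□⁻¹x)`; hence (F6), and (F5) by the
adjunction between image and preimage of filters under `□`.
-/

theorem Sgn.flip_flip (s : Sgn) : s.flip.flip = s := by
  cases s <;> rfl

section SignedOrder

/-- The order of `P¹ = P` or of `P^∂ = Pᵒᵖ`, as a relation on `P`. Stating results for an arbitrary
sort `s` proves each fact together with its order dual. -/
def SignedLE {P : Type u} [LE P] : Sgn → P → P → Prop
  | Sgn.one => fun a b => a ≤ b
  | Sgn.del => fun a b => b ≤ a

theorem signedLE_flip {P : Type u} [LE P] {s : Sgn} {a b : P} :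
    SignedLE s.flip a b ↔ SignedLE s b a := by
  cases s <;> exact Iff.rfl

namespace SignedLE

theorem refl {P : Type u} [Preorder P] (s : Sgn) (a : P) : SignedLE s a a := by
  cases s <;> exact le_refl a

theorem trans {P : Type u} [Preorder P] {s : Sgn} {a b c : P} (hab : SignedLE s a b)
    (hbc : SignedLE s b c) : SignedLE s a c := by
  cases s
  · exact le_trans hab hbc
  · exact le_trans hbc hab

theorem antisymm {P : Type u} [PartialOrder P] {s : Sgn} {a b : P} (hab : SignedLE s a b)
    (hba : SignedLE s b a) : a = b := by
  cases s
  · exact le_antisymm hab hba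
  · exact le_antisymm hba hab

theorem eq_of_forall_le_iff {P : Type u} [PartialOrder P] {s : Sgn} {a b : P}
    (h : ∀ c, SignedLE s a c ↔ SignedLE s b c) : a = b :=
  ((h b).2 (refl s b)).antisymm ((h a).1 (refl s a))

theorem update_update {P : Type u} [LE P] {ι : Type*} [DecidableEq ι] {s : ι → Sgn}
    {a b : ι → P} {k : ι} {c d : P} (hk : SignedLE (s k) c d)
    (h : ∀ i, i ≠ k → SignedLE (s i) (a i) (b i)) (i : ι) :
    SignedLE (s i) (Function.update a k c i) (Function.update b k d i) := by
  rcases eq_or_ne i k with rfl | hi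
  · simpa only [Function.update_self] using hk
  · simpa only [Function.update_of_ne hi] using h i hi

end SignedLE

variable {L : Type u} [Lattice L] {s : Sgn} {a b c : L}

theorem signedSup_le_iff : SignedLE s (signedSup s a b) c ↔ SignedLE s a c ∧ SignedLE s b c := by
  cases s
  · exact sup_le_iff
  · exact le_inf_iff

theorem le_signedSup_flip_iff :
    SignedLE s a (signedSup s.flip b c) ↔ SignedLE s a b ∧ SignedLE s a c := by
  simpa only [signedLE_flip] using signedSup_le_iff (s := s.flip) (a := b) (b := c) (c := a)

theorem signedSup_flip_le_left : SignedLE s (signedSup s.flip a b) a :=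
  (le_signedSup_flip_iff.1 (.refl s _)).1

theorem signedSup_flip_le_right : SignedLE s (signedSup s.flip a b) b :=
  (le_signedSup_flip_iff.1 (.refl s _)).2

theorem signedSup_eq_right_iff : signedSup s a b = b ↔ SignedLE s a b := by
  cases s
  · exact sup_eq_right
  · exact inf_eq_right

theorem signedBot_le [BoundedOrder L] (s : Sgn) (a : L) : SignedLE s (signedBot s) a := by
  cases s
  · exact bot_le (α := L)
  · exact le_top (α := L)

theorem le_signedBot_flip [BoundedOrder L] (s : Sgn) (a : L) : SignedLE s a (signedBot s.flip) :=
  signedLE_flip.1 (signedBot_le s.flip a)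

end SignedOrder

section SignedSSup

variable {C : Type w} [CompleteLattice C] {s : Sgn} {T : Set C} {c : C}

/-- The join in `C¹ = C` or in `C^∂ = Cᵒᵖ` of a subset of `C`; the meet in `C^s` is
`signedSSup s.flip`. -/
def signedSSup : Sgn → Set C → C
  | Sgn.one => sSup
  | Sgn.del => sInf

theorem signedSSup_le_iff : SignedLE s (signedSSup s T) c ↔ ∀ t ∈ T, SignedLE s t c := by
  cases s
  · exact sSup_le_iff
  · exact le_sInf_iff

theorem le_signedSSup_flip_iff :
    SignedLE s c (signedSSup s.flip T) ↔ ∀ t ∈ T, SignedLE s c t := by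
  simpa only [signedLE_flip] using signedSSup_le_iff (s := s.flip) (T := T) (c := c)

theorem le_signedSSup (hc : c ∈ T) : SignedLE s c (signedSSup s T) :=
  signedSSup_le_iff.1 (.refl s _) c hc

theorem signedSSup_flip_le (hc : c ∈ T) : SignedLE s (signedSSup s.flip T) c :=
  le_signedSSup_flip_iff.1 (.refl s _) c hc

theorem signedSSup_flip_anti {T' : Set C} (h : T ⊆ T') :
    SignedLE s (signedSSup s.flip T') (signedSSup s.flip T) :=
  le_signedSSup_flip_iff.2 fun _ ht => signedSSup_flip_le (h ht)

end SignedSSup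

namespace IsNormalOp

variable {L : Type u} [Lattice L] [BoundedOrder L] {δ : DistType} {f : (Fin δ.arity → L) → L}

theorem le_update (hf : IsNormalOp δ f) {k : Fin δ.arity} {a : Fin δ.arity → L} {b : L}
    (h : SignedLE (δ.inp k) (a k) b) : SignedLE δ.out (f a) (f (Function.update a k b)) := by
  have hadd := hf.additive k a (a k) b
  rw [signedSup_eq_right_iff.2 h, Function.update_eq_self] at hadd
  exact signedSup_eq_right_iff.1 hadd.symm

theorem mono (hf : IsNormalOp δ f) {a b : Fin δ.arity → L}
    (h : ∀ k, SignedLE (δ.inp k) (a k) (b k)) : SignedLE δ.out (f a) (f b) := by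
  suffices ∀ S : Finset (Fin δ.arity), SignedLE δ.out (f a) (f (S.piecewise b a)) by
    simpa only [Finset.piecewise_univ] using this Finset.univ
  intro S
  induction S using Finset.induction_on with
  | empty => simpa only [Finset.piecewise_empty] using SignedLE.refl δ.out (f a)
  | insert k S hk ih =>
    rw [Finset.piecewise_insert]
    refine ih.trans (hf.le_update ?_)
    rw [Finset.piecewise_eq_of_notMem S b a hk]
    exact h k

end IsNormalOp

section SignedExtension

variable {L : Type u} {C : Type w} [CompleteLattice C] {α : L → C}

/-- The closed elements of the completion `α : L → C` for `s = 1`, the open ones for `s = ∂`. -/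
def IsSignedClosed (α : L → C) : Sgn → C → Prop
  | Sgn.one => IsClosedElt α
  | Sgn.del => IsOpenElt α

theorem isSignedClosed_iff {s : Sgn} {c : C} :
    IsSignedClosed α s c ↔ ∃ S : Set L, c = signedSSup s.flip (α '' S) := by
  cases s <;> exact Iff.rfl

/-- The σ-extension of `f` for `t = 1`, its π-extension for `t = ∂`. -/
def signedExt (t : Sgn) (α : L → C) {n : ℕ} (f : (Fin n → L) → L) (x : Fin n → C) : C :=
  signedSSup t {c | ∃ k o : Fin n → C, (∀ i, IsClosedElt α (k i)) ∧ (∀ i, IsOpenElt α (o i)) ∧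
    k ≤ x ∧ x ≤ o ∧ c = signedSSup t.flip
      {d | ∃ a : Fin n → L, (∀ i, k i ≤ α (a i)) ∧ (∀ i, α (a i) ≤ o i) ∧ d = α (f a)}}

end SignedExtension

namespace Frame

variable {J : Type v} {σ : J → DistType} (F : Frame.{u, v} σ) {s : Sgn}

theorem mem_up_singleton {z : F.Z s} {t : F.Z s.flip} : t ∈ F.up s {z} ↔ F.gal s z t :=
  ⟨fun h => h z rfl, fun h _ hw => Set.mem_singleton_iff.1 hw ▸ h⟩

theorem up_cl (s : Sgn) (U : Set (F.Z s)) : F.up s (F.cl s U) = F.up s U :=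
  Set.Subset.antisymm (fun _ ht _ hz => ht _ (F.subset_cl s U hz)) fun _ ht _ hz => hz _ ht

theorem isGalois_up (s : Sgn) (U : Set (F.Z s)) : F.IsGalois s.flip (F.up s U) := by
  cases s <;> exact F.up_cl _ U

theorem isGalois_setOf_gal (t : F.Z s.flip) : F.IsGalois s {z | F.gal s z t} := by
  have h : {z | F.gal s z t} = F.down s {t} :=
    Set.ext fun _ => ⟨fun hz _ hr => Set.mem_singleton_iff.1 hr ▸ hz, fun hz => hz t rfl⟩
  rw [h]
  exact F.down_up_down s {t}

theorem Gam_eq_cl (s : Sgn) (z : F.Z s) : F.Gam s z = F.cl s {z} :=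
  Set.ext fun _ => ⟨fun h _ hr => F.mem_up_singleton.1 (h hr),
    fun h r hr => F.mem_up_singleton.2 (h r hr)⟩

variable {F} in
theorem IsGalois.cl_subset_iff {U V : Set (F.Z s)} (hV : F.IsGalois s V) :
    F.cl s U ⊆ V ↔ U ⊆ V :=
  ⟨(F.subset_cl s U).trans, fun h => (F.cl_mono s h).trans_eq hV⟩

theorem Gam_subset_Gam_iff {z t : F.Z s} : F.Gam s z ⊆ F.Gam s t ↔ F.le s t z := by
  rw [F.Gam_eq_cl s z, (F.isGalois_Gam s t).cl_subset_iff, Set.singleton_subset_iff]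
  exact Iff.rfl

section Adjunction

theorem ofSort_del_val (V : Set (F.Z Sgn.del)) : (F.ofSort Sgn.del V).1 = F.down Sgn.one V :=
  F.up_cl Sgn.del V

theorem ofSort_le_iff {V : Set (F.Z s)} {A : F.Stable} :
    SignedLE s (F.ofSort s V) A ↔ V ⊆ F.toSort A s := by
  cases s
  · exact IsGalois.cl_subset_iff A.2
  · change A.1 ⊆ (F.ofSort Sgn.del V).1 ↔ _
    rw [ofSort_del_val]
    exact ⟨fun h y hy x hx => h hx y hy, fun h x hx y hy => h hy x hx⟩

theorem toSort_ofSort (s : Sgn) (V : Set (F.Z s)) : F.toSort (F.ofSort s V) s = F.cl s V := by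
  cases s
  · rfl
  · exact F.cl_cl Sgn.del V

theorem ofSort_toSort (A : F.Stable) (s : Sgn) : F.ofSort s (F.toSort A s) = A := by
  cases s
  · exact Subtype.ext A.2
  · exact Subtype.ext ((F.ofSort_del_val _).trans A.2)

theorem ofSort_congr {U V : Set (F.Z s)} (h : F.up s U = F.up s V) :
    F.ofSort s U = F.ofSort s V := by
  rw [← F.ofSort_toSort (F.ofSort s U) s, toSort_ofSort, cl, h, ← cl, ← toSort_ofSort,
    ofSort_toSort]

theorem ofSort_union (s : Sgn) (U V : Set (F.Z s)) :
    F.ofSort s (U ∪ V) = signedSup s (F.ofSort s U) (F.ofSort s V) :=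
  SignedLE.eq_of_forall_le_iff (s := s) fun A => by
    simp only [ofSort_le_iff, signedSup_le_iff, Set.union_subset_iff]

theorem ofSort_empty (s : Sgn) : F.ofSort s ∅ = signedBot s :=
  (F.ofSort_le_iff.2 (Set.empty_subset _)).antisymm (signedBot_le s _)

theorem ofSort_biUnion {ι : Type*} (P : Set ι) (V : ι → Set (F.Z s)) :
    F.ofSort s (⋃ i ∈ P, V i) = signedSSup s ((fun i => F.ofSort s (V i)) '' P) :=
  SignedLE.eq_of_forall_le_iff (s := s) fun A => by
    simp only [ofSort_le_iff, signedSSup_le_iff, Set.forall_mem_image, Set.iUnion₂_subset_iff]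

theorem toSort_signedSup (s : Sgn) (A B : F.Stable) :
    F.toSort (signedSup s A B) s = F.cl s (F.toSort A s ∪ F.toSort B s) := by
  rw [← toSort_ofSort, ofSort_union, ofSort_toSort, ofSort_toSort]

theorem toSort_signedBot (s : Sgn) : F.toSort (signedBot s) s = F.cl s ∅ := by
  rw [← toSort_ofSort, ofSort_empty]

end Adjunction

section Point

/-- The stable set generated by the point `z`: the closed element `Γ z` for `s = 1` and the open
element `{z}'` for `s = ∂`. -/
def point (s : Sgn) (z : F.Z s) : F.Stable := F.ofSort s {z}

theorem point_le_iff {z : F.Z s} {A : F.Stable} :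
    SignedLE s (F.point s z) A ↔ z ∈ F.toSort A s := by
  rw [point, ofSort_le_iff, Set.singleton_subset_iff]

theorem point_le_point_iff {z t : F.Z s} :
    SignedLE s (F.point s t) (F.point s z) ↔ F.le s z t := by
  rw [point_le_iff, point, toSort_ofSort, ← Gam_eq_cl]
  exact Iff.rfl

theorem eq_of_forall_point_le_iff {A B : F.Stable}
    (h : ∀ z, SignedLE s (F.point s z) A ↔ SignedLE s (F.point s z) B) : A = B := by
  simp only [point_le_iff] at h
  rw [← F.ofSort_toSort A s, Set.ext h, ofSort_toSort]

theorem point_one_le_point_del_iff {x : F.Z Sgn.one} {y : F.Z Sgn.del} :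
    F.point Sgn.one x ≤ F.point Sgn.del y ↔ F.gal Sgn.one x y := by
  refine (F.point_le_iff (s := Sgn.one)).trans ?_
  change x ∈ (F.ofSort Sgn.del {y}).1 ↔ _
  rw [ofSort_del_val]
  exact ⟨fun h => h y rfl, fun h _ hr => Set.mem_singleton_iff.1 hr ▸ h⟩

theorem ofSort_Gam (s : Sgn) (z : F.Z s) : F.ofSort s (F.Gam s z) = F.point s z :=
  F.ofSort_congr (by rw [Gam_eq_cl, up_cl])

theorem eq_signedSSup_point (A : F.Stable) (s : Sgn) :
    A = signedSSup s (F.point s '' F.toSort A s) := by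
  conv_lhs => rw [← F.ofSort_toSort A s, ← Set.biUnion_of_singleton (F.toSort A s)]
  exact F.ofSort_biUnion _ _

theorem iSup_GamS (A : F.Stable) : ⨆ x ∈ A.1, F.GamS x = A := by
  have hGam (x : F.Z Sgn.one) : F.GamS x = F.point Sgn.one x := Subtype.ext (F.Gam_eq_cl _ x)
  simp only [hGam, ← sSup_image]
  exact (F.eq_signedSSup_point A Sgn.one).symm

end Point

section ComplexOp

variable {j : J} {W : ∀ k, Set (F.Z ((σ j).inp k))} {k : Fin (σ j).arity}

theorem mem_up_image {t : F.Z (σ j).out.flip} :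
    t ∈ F.up _ (F.image j W) ↔ ∀ p : ∀ k, F.Z ((σ j).inp k), (∀ k, p k ∈ W k) → F.Rdual j t p :=
  ⟨fun h p hp z hz => h z ⟨p, hz, hp⟩, fun h z ⟨p, hz, hp⟩ => h p hp z hz⟩

theorem mem_update_iff {U : Set (F.Z ((σ j).inp k))} {p : ∀ k, F.Z ((σ j).inp k)} :
    (∀ i, p i ∈ Function.update W k U i) ↔ p k ∈ U ∧ ∀ i, i ≠ k → p i ∈ W i :=
  Function.forall_update_iff W fun i V => p i ∈ V

theorem image_update_union (W : ∀ k, Set (F.Z ((σ j).inp k))) (U V : Set (F.Z ((σ j).inp k))) :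
    F.image j (Function.update W k (U ∪ V)) =
      F.image j (Function.update W k U) ∪ F.image j (Function.update W k V) := by
  ext z
  simp only [image, mem_update_iff, Set.mem_union, Set.mem_ofPred_eq, or_and_right, and_or_left,
    exists_or]

theorem image_update_empty (W : ∀ k, Set (F.Z ((σ j).inp k))) :
    F.image j (Function.update W k ∅) = ∅ :=
  Set.eq_empty_of_forall_notMem fun _ ⟨_, _, hp⟩ => (F.mem_update_iff.1 hp).1

theorem ofSort_image_update_cl
    (hk : ∀ t p, F.IsGalois ((σ j).inp k) {z | F.Rdual j t (Function.update p k z)})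
    (W : ∀ k, Set (F.Z ((σ j).inp k))) (U : Set (F.Z ((σ j).inp k))) :
    F.ofSort _ (F.image j (Function.update W k (F.cl _ U))) =
      F.ofSort _ (F.image j (Function.update W k U)) := by
  refine F.ofSort_congr (Set.ext fun t => ?_)
  simp only [mem_up_image, mem_update_iff]
  refine ⟨fun h p hp => h p ⟨F.subset_cl _ _ hp.1, hp.2⟩, fun h p hp => ?_⟩
  have hU : F.cl _ U ⊆ {z | F.Rdual j t (Function.update p k z)} :=
    (hk t p).cl_subset_iff.2 fun z hz => h _
      ⟨by rwa [Function.update_self], fun i hi => by rw [Function.update_of_ne hi]; exact hp.2 i hi⟩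
  simpa only [Set.mem_ofPred_eq, Function.update_eq_self] using hU hp.1

theorem toSort_update (A : Fin (σ j).arity → F.Stable) (k : Fin (σ j).arity) (B : F.Stable) :
    (fun i => F.toSort (Function.update A k B i) ((σ j).inp i)) =
      Function.update (fun i => F.toSort (A i) ((σ j).inp i)) k (F.toSort B ((σ j).inp k)) :=
  funext (Function.apply_update (fun i C => F.toSort C ((σ j).inp i)) A k B)

theorem isNormalOp_complexOp (hF : F.Smooth) (j : J) : IsNormalOp (σ j) (F.complexOp j) where
  additive k A B C := by
    simp only [complexOp, toSort_update, toSort_signedSup]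
    rw [F.ofSort_image_update_cl ((hF j).2 k), image_update_union, ofSort_union]
  normal k A := by
    simp only [complexOp, toSort_update, toSort_signedBot]
    rw [F.ofSort_image_update_cl ((hF j).2 k), image_update_empty, ofSort_empty]

end ComplexOp

end Frame

section DualPoint

variable {L : Type u} [Lattice L] {s : Sgn} {S : Set L}

/-- `S` is a filter of the lattice `L^s`: a filter of `L` for `s = 1`, an ideal of `L` for
`s = ∂`. -/
structure IsSignedFilter (s : Sgn) (S : Set L) : Prop where
  nonempty : S.Nonempty
  inf_mem : ∀ {a b}, a ∈ S → b ∈ S → signedSup s.flip a b ∈ S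
  mem_of_le : ∀ {a b}, SignedLE s a b → a ∈ S → b ∈ S

namespace IsSignedFilter

theorem isPFilter (hS : IsSignedFilter Sgn.one S) : Order.IsPFilter S :=
  .of_def hS.nonempty (fun _ ha _ hb => ⟨_, hS.inf_mem ha hb, inf_le_left, inf_le_right⟩)
    hS.mem_of_le

theorem isIdeal (hS : IsSignedFilter Sgn.del S) : Order.IsIdeal S where
  IsLowerSet _ _ h ha := hS.mem_of_le h ha
  Nonempty := hS.nonempty
  Directed _ ha _ hb := ⟨_, hS.inf_mem ha hb, le_sup_left (α := L), le_sup_right (α := L)⟩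

/-- A signed filter as a point of the dual frame. -/
def toPoint : ∀ {s : Sgn} {S : Set L}, IsSignedFilter s S → dualPoint L s
  | Sgn.one, _, hS => hS.isPFilter.toPFilter
  | Sgn.del, _, hS => hS.isIdeal.toIdeal

theorem mem_toPoint (hS : IsSignedFilter s S) {a : L} : dualMem a s hS.toPoint ↔ a ∈ S := by
  cases s <;> exact Iff.rfl

theorem inf_mem_iff (hS : IsSignedFilter s S) {a b : L} :
    signedSup s.flip a b ∈ S ↔ a ∈ S ∧ b ∈ S :=
  ⟨fun h => ⟨hS.mem_of_le signedSup_flip_le_left h, hS.mem_of_le signedSup_flip_le_right h⟩,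
    fun h => hS.inf_mem h.1 h.2⟩

theorem top_mem [BoundedOrder L] (hS : IsSignedFilter s S) : signedBot s.flip ∈ S :=
  have ⟨a, ha⟩ := hS.nonempty
  hS.mem_of_le (le_signedBot_flip s a) ha

end IsSignedFilter

theorem isSignedFilter_dualMem : ∀ {s : Sgn} (z : dualPoint L s),
    IsSignedFilter s {a | dualMem a s z}
  | Sgn.one, (x : Order.PFilter L) => ⟨x.nonempty, fun ha hb => x.inf_mem ha hb, x.mem_of_le⟩
  | Sgn.del, (y : Order.Ideal L) => ⟨y.nonempty, fun ha hb => y.sup_mem ha hb, fun h => y.lower h⟩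

theorem dualMem_flip_of_le {t : dualPoint L s.flip} {a b : L} (hab : SignedLE s a b)
    (hb : dualMem b s.flip t) : dualMem a s.flip t :=
  (isSignedFilter_dualMem t).mem_of_le (signedLE_flip.2 hab) hb

theorem dualPoint_ext {z t : dualPoint L s} (h : ∀ a, dualMem a s z ↔ dualMem a s t) :
    z = t := by
  cases s
  · exact SetLike.ext (A := Order.PFilter L) h
  · exact SetLike.ext (A := Order.Ideal L) h

theorem isSignedFilter_setOf_le (s : Sgn) (a : L) : IsSignedFilter s {b | SignedLE s a b} where
  nonempty := ⟨a, .refl s a⟩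
  inf_mem hb hc := le_signedSup_flip_iff.2 ⟨hb, hc⟩
  mem_of_le hbc hb := SignedLE.trans hb hbc

end DualPoint

namespace IsNormalOp

variable {L : Type u} [Lattice L] [BoundedOrder L] {δ : DistType} {f : (Fin δ.arity → L) → L}

theorem isSignedFilter_pointOp (hf : IsNormalOp δ f) (p : ∀ k, dualPoint L (δ.inp k)) :
    IsSignedFilter δ.out
      {b | ∃ a, (∀ k, dualMem (a k) (δ.inp k) (p k)) ∧ SignedLE δ.out (f a) b} where
  nonempty := ⟨_, _, fun k => (isSignedFilter_dualMem (p k)).top_mem, .refl _ _⟩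
  inf_mem := fun ⟨_, ha, hab⟩ ⟨_, ha', hab'⟩ =>
    ⟨_, fun k => (isSignedFilter_dualMem (p k)).inf_mem (ha k) (ha' k), le_signedSup_flip_iff.2
      ⟨(hf.mono fun _ => signedSup_flip_le_left).trans hab,
        (hf.mono fun _ => signedSup_flip_le_right).trans hab'⟩⟩
  mem_of_le := fun hbc ⟨a, ha, hab⟩ => ⟨a, ha, hab.trans hbc⟩

/-- The point operator generated by `f`: the filter or ideal generated by the values of `f` on the
members of the arguments. -/
def pointOp (hf : IsNormalOp δ f) (p : ∀ k, dualPoint L (δ.inp k)) : dualPoint L δ.out :=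
  (hf.isSignedFilter_pointOp p).toPoint

theorem mem_pointOp {hf : IsNormalOp δ f} {p : ∀ k, dualPoint L (δ.inp k)} {b : L} :
    dualMem b δ.out (hf.pointOp p) ↔
      ∃ a, (∀ k, dualMem (a k) (δ.inp k) (p k)) ∧ SignedLE δ.out (f a) b :=
  (hf.isSignedFilter_pointOp p).mem_toPoint

variable {k : Fin δ.arity} {t : dualPoint L δ.out.flip} {p : ∀ k, dualPoint L (δ.inp k)}

theorem isSignedFilter_residual (hf : IsNormalOp δ f) (k : Fin δ.arity)
    (t : dualPoint L δ.out.flip) (p : ∀ k, dualPoint L (δ.inp k)) :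
    IsSignedFilter (δ.inp k).flip {c | ∃ a, (∀ i, i ≠ k → dualMem (a i) (δ.inp i) (p i)) ∧
      dualMem (f (Function.update a k c)) δ.out.flip t} where
  nonempty := by
    refine ⟨signedBot (δ.inp k), _, fun i _ => (isSignedFilter_dualMem (p i)).top_mem, ?_⟩
    rw [hf.normal]
    simpa only [Sgn.flip_flip, Set.mem_ofPred_eq] using (isSignedFilter_dualMem t).top_mem
  inf_mem := by
    rintro c d ⟨a, ha, hac⟩ ⟨b, hb, hbd⟩
    let e : Fin δ.arity → L := fun i => signedSup (δ.inp i).flip (a i) (b i)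
    have hc : dualMem (f (Function.update e k c)) δ.out.flip t := dualMem_flip_of_le
      (hf.mono (.update_update (.refl _ c) fun _ _ => signedSup_flip_le_left)) hac
    have hd : dualMem (f (Function.update e k d)) δ.out.flip t := dualMem_flip_of_le
      (hf.mono (.update_update (.refl _ d) fun _ _ => signedSup_flip_le_right)) hbd
    refine ⟨e, fun i hi => (isSignedFilter_dualMem (p i)).inf_mem (ha i hi) (hb i hi), ?_⟩
    rw [Sgn.flip_flip, hf.additive]
    simpa only [Sgn.flip_flip, Set.mem_ofPred_eq] using (isSignedFilter_dualMem t).inf_mem hc hd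
  mem_of_le := fun hcd ⟨a, ha, hac⟩ => ⟨a, ha, dualMem_flip_of_le
    (hf.mono (.update_update (signedLE_flip.1 hcd) fun _ _ => .refl _ _)) hac⟩

/-- The filter or ideal of those `c` which `f`, with `c` in its `k`-th place and members of `p` in
the other ones, can send into `t`. -/
def residual (hf : IsNormalOp δ f) (k : Fin δ.arity) (t : dualPoint L δ.out.flip)
    (p : ∀ k, dualPoint L (δ.inp k)) : dualPoint L (δ.inp k).flip :=
  (hf.isSignedFilter_residual k t p).toPoint

theorem mem_residual {hf : IsNormalOp δ f} {c : L} :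
    dualMem c (δ.inp k).flip (hf.residual k t p) ↔
      ∃ a, (∀ i, i ≠ k → dualMem (a i) (δ.inp i) (p i)) ∧
        dualMem (f (Function.update a k c)) δ.out.flip t :=
  (hf.isSignedFilter_residual k t p).mem_toPoint

end IsNormalOp

namespace dualFrame

variable {J : Type v} {δ : J → DistType} {L : Type u} [Lattice L] [BoundedOrder L] (A : NLE δ L)
  {s : Sgn}

theorem gal_iff {z : (dualFrame A).Z s} {t : (dualFrame A).Z s.flip} :
    (dualFrame A).gal s z t ↔ ∃ a : L, dualMem a s z ∧ dualMem a s.flip t := by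
  cases s
  · exact Set.nonempty_iff_ne_empty.symm
  · exact Set.nonempty_iff_ne_empty.symm.trans (exists_congr fun _ => and_comm)

theorem le_iff {z t : (dualFrame A).Z s} :
    (dualFrame A).le s z t ↔ ∀ a : L, dualMem a s z → dualMem a s t := by
  constructor
  · intro h a ha
    let principal := isSignedFilter_setOf_le s.flip a
    have hz : (dualFrame A).gal s z principal.toPoint :=
      (gal_iff A).2 ⟨a, ha, principal.mem_toPoint.2 (.refl _ a)⟩
    obtain ⟨b, hbt, hab⟩ := (gal_iff A).1 <|
      (dualFrame A).mem_up_singleton.1 (h ((dualFrame A).mem_up_singleton.2 hz))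
    exact (isSignedFilter_dualMem t).mem_of_le (signedLE_flip.1 (principal.mem_toPoint.1 hab)) hbt
  · intro h r hr
    obtain ⟨a, haz, har⟩ := (gal_iff A).1 ((dualFrame A).mem_up_singleton.1 hr)
    exact (dualFrame A).mem_up_singleton.2 ((gal_iff A).2 ⟨a, h a haz, har⟩)

theorem separated : (dualFrame A).Separated := fun _ _ _ hzt htz =>
  dualPoint_ext fun a => ⟨(le_iff A).1 hzt a, (le_iff A).1 htz a⟩

variable {j : J}

theorem R_iff {z : (dualFrame A).Z (δ j).out} {p : ∀ k, (dualFrame A).Z ((δ j).inp k)} :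
    (dualFrame A).R j z p ↔ (dualFrame A).le _ ((A.isNormalOp j).pointOp p) z := by
  refine Iff.trans ?_ (le_iff A).symm
  constructor
  · intro h b hb
    obtain ⟨a, ha, hab⟩ := IsNormalOp.mem_pointOp.1 hb
    exact (isSignedFilter_dualMem z).mem_of_le hab (h a ha)
  · exact fun h a ha => h _ (IsNormalOp.mem_pointOp.2 ⟨a, ha, .refl _ _⟩)

theorem setOf_R_eq_Gam (j : J) (p : ∀ k, (dualFrame A).Z ((δ j).inp k)) :
    {z | (dualFrame A).R j z p} = (dualFrame A).Gam _ ((A.isNormalOp j).pointOp p) :=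
  Set.ext fun _ => R_iff A

theorem R_of_le {z t : (dualFrame A).Z (δ j).out} {p : ∀ k, (dualFrame A).Z ((δ j).inp k)}
    (hzt : (dualFrame A).le _ z t) (hz : (dualFrame A).R j z p) : (dualFrame A).R j t p :=
  fun a ha => (le_iff A).1 hzt _ (hz a ha)

theorem forall_dualMem_update_iff {p : ∀ k, (dualFrame A).Z ((δ j).inp k)} {k : Fin (δ j).arity}
    {z : (dualFrame A).Z ((δ j).inp k)} {a : Fin (δ j).arity → L} :
    (∀ i, dualMem (a i) _ (Function.update p k z i)) ↔
      dualMem (a k) _ z ∧ ∀ i, i ≠ k → dualMem (a i) _ (p i) :=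
  Function.forall_update_iff p fun i q => dualMem (a i) ((δ j).inp i) q

theorem R_update_of_le {z : (dualFrame A).Z (δ j).out} {p : ∀ k, (dualFrame A).Z ((δ j).inp k)}
    {k : Fin (δ j).arity} {t : (dualFrame A).Z ((δ j).inp k)} (htp : (dualFrame A).le _ t (p k))
    (hz : (dualFrame A).R j z p) : (dualFrame A).R j z (Function.update p k t) := by
  intro a ha
  rw [forall_dualMem_update_iff] at ha
  refine hz a fun i => ?_
  rcases eq_or_ne i k with rfl | hi
  · exact (le_iff A).1 htp _ ha.1
  · exact ha.2 i hi

theorem Rdual_iff {t : (dualFrame A).Z (δ j).out.flip}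
    {p : ∀ k, (dualFrame A).Z ((δ j).inp k)} :
    (dualFrame A).Rdual j t p ↔
      ∃ a, (∀ k, dualMem (a k) ((δ j).inp k) (p k)) ∧ dualMem (A.op j a) (δ j).out.flip t := by
  constructor
  · intro h
    obtain ⟨b, hb, hbt⟩ := (gal_iff A).1 (h _ ((R_iff A).2 Set.Subset.rfl))
    obtain ⟨a, ha, hab⟩ := IsNormalOp.mem_pointOp.1 hb
    exact ⟨a, ha, dualMem_flip_of_le hab hbt⟩
  · exact fun ⟨a, ha, hat⟩ z hz => (gal_iff A).2 ⟨_, hz a ha, hat⟩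

theorem Rdual_update_iff {t : (dualFrame A).Z (δ j).out.flip}
    {p : ∀ k, (dualFrame A).Z ((δ j).inp k)} {k : Fin (δ j).arity}
    {z : (dualFrame A).Z ((δ j).inp k)} :
    (dualFrame A).Rdual j t (Function.update p k z) ↔
      (dualFrame A).gal _ z ((A.isNormalOp j).residual k t p) := by
  refine (Rdual_iff A).trans (Iff.trans ?_ (gal_iff A).symm)
  simp only [forall_dualMem_update_iff]
  constructor
  · rintro ⟨a, ⟨hak, ha⟩, hat⟩
    refine ⟨a k, hak, IsNormalOp.mem_residual.2 ⟨a, ha, ?_⟩⟩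
    rwa [Function.update_eq_self]
  · rintro ⟨c, hcz, hc⟩
    obtain ⟨a, ha, hat⟩ := IsNormalOp.mem_residual.1 hc
    refine ⟨Function.update a k c, ⟨by rwa [Function.update_self], fun i hi => ?_⟩, hat⟩
    rw [Function.update_of_ne hi]
    exact ha i hi

theorem smooth : (dualFrame A).Smooth := fun j =>
  ⟨fun _ => (dualFrame A).isGalois_up _ _, fun k t p => by
    simpa only [Rdual_update_iff] using (dualFrame A).isGalois_setOf_gal _⟩

section Zeta

variable {a b : L} {z t : (dualFrame A).Z s}

theorem mem_toSort_zeta : z ∈ (dualFrame A).toSort (zeta A a) s ↔ dualMem a s z := by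
  cases s
  · exact Iff.rfl
  · let principal := isSignedFilter_setOf_le Sgn.one a
    constructor
    · intro h
      have ha := principal.mem_toPoint.2 (SignedLE.refl Sgn.one a)
      obtain ⟨b, hab, hb⟩ := (gal_iff A).1 (h principal.toPoint ha)
      exact dualMem_flip_of_le (s := Sgn.one) (principal.mem_toPoint.1 hab) hb
    · exact fun h x hx => (gal_iff A (s := Sgn.one)).2 ⟨a, hx, h⟩

theorem point_le_zeta_iff :
    SignedLE s ((dualFrame A).point s z) (zeta A a) ↔ dualMem a s z :=
  (dualFrame A).point_le_iff.trans (mem_toSort_zeta A)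

theorem point_le_point_iff :
    SignedLE s ((dualFrame A).point s t) ((dualFrame A).point s z) ↔
      ∀ a : L, dualMem a s z → dualMem a s t :=
  (dualFrame A).point_le_point_iff.trans (le_iff A)

theorem zeta_eq_point (s : Sgn) (a : L) :
    zeta A a = (dualFrame A).point s (isSignedFilter_setOf_le s a).toPoint := by
  let principal := isSignedFilter_setOf_le s a
  refine (dualFrame A).eq_of_forall_point_le_iff (s := s) fun t => ?_
  refine (point_le_zeta_iff A).trans (Iff.trans ?_ (point_le_point_iff A).symm)
  exact ⟨fun ha b hb => (isSignedFilter_dualMem t).mem_of_le (principal.mem_toPoint.1 hb) ha,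
    fun h => h a (principal.mem_toPoint.2 (SignedLE.refl s a))⟩

theorem zeta_le_zeta_iff : SignedLE s (zeta A a) (zeta A b) ↔ SignedLE s a b := by
  rw [zeta_eq_point A s a]
  exact (point_le_zeta_iff A).trans (isSignedFilter_setOf_le s a).mem_toPoint

theorem zeta_signedInf (s : Sgn) (a b : L) :
    zeta A (signedSup s.flip a b) = signedSup s.flip (zeta A a) (zeta A b) := by
  refine (dualFrame A).eq_of_forall_point_le_iff (s := s) fun t => ?_
  simp only [le_signedSup_flip_iff, point_le_zeta_iff]
  exact (isSignedFilter_dualMem t).inf_mem_iff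

theorem zeta_signedTop (s : Sgn) : zeta A (signedBot s.flip) = signedBot s.flip :=
  (dualFrame A).eq_of_forall_point_le_iff (s := s) fun t =>
    iff_of_true ((point_le_zeta_iff A).2 (isSignedFilter_dualMem t).top_mem) (le_signedBot_flip s _)

theorem point_eq_signedSSup_zeta (z : (dualFrame A).Z s) :
    (dualFrame A).point s z = signedSSup s.flip (zeta A '' {a | dualMem a s z}) := by
  refine (dualFrame A).eq_of_forall_point_le_iff (s := s) fun t => ?_
  rw [point_le_point_iff, le_signedSSup_flip_iff, Set.forall_mem_image]
  simp only [point_le_zeta_iff]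
  exact Iff.rfl

theorem le_point_iff {B : (dualFrame A).Stable} :
    SignedLE s B ((dualFrame A).point s z) ↔ ∀ a : L, dualMem a s z → SignedLE s B (zeta A a) := by
  rw [point_eq_signedSSup_zeta, le_signedSSup_flip_iff, Set.forall_mem_image]
  exact Iff.rfl

theorem isSignedFilter_setOf_le_zeta (s : Sgn) (B : (dualFrame A).Stable) :
    IsSignedFilter s {a | SignedLE s B (zeta A a)} where
  nonempty := ⟨signedBot s.flip, by
    rw [Set.mem_ofPred_eq, zeta_signedTop]
    exact le_signedBot_flip s B⟩
  inf_mem ha hb := by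
    rw [Set.mem_ofPred_eq, zeta_signedInf]
    exact le_signedSup_flip_iff.2 ⟨ha, hb⟩
  mem_of_le hab ha := SignedLE.trans ha ((zeta_le_zeta_iff A).2 hab)

theorem isSignedClosed_zeta_iff {B : (dualFrame A).Stable} :
    IsSignedClosed (zeta A) s B ↔ ∃ z, B = (dualFrame A).point s z := by
  rw [isSignedClosed_iff]
  constructor
  · rintro ⟨S, rfl⟩
    let filter := isSignedFilter_setOf_le_zeta A s (signedSSup s.flip (zeta A '' S))
    refine ⟨filter.toPoint, SignedLE.antisymm (s := s) ?_ ?_⟩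
    · exact (le_point_iff A).2 fun a ha => filter.mem_toPoint.1 ha
    · exact le_signedSSup_flip_iff.2 (Set.forall_mem_image.2 fun a ha => (point_le_zeta_iff A).2
        (filter.mem_toPoint.2 (signedSSup_flip_le (Set.mem_image_of_mem _ ha))))
  · rintro ⟨z, rfl⟩
    exact ⟨_, point_eq_signedSSup_zeta A z⟩

theorem exists_point_le_signedSSup {T : Set (dualFrame A).Stable}
    (hT : ∀ c ∈ T, IsSignedClosed (zeta A) s c) :
    ∃ z, SignedLE s ((dualFrame A).point s z) (signedSSup s.flip T) ∧ ∀ a : L, dualMem a s z →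
      ∃ T₁ ⊆ T, T₁.Finite ∧ SignedLE s (signedSSup s.flip T₁) (zeta A a) := by
  have hfilter : IsSignedFilter s
      {a | ∃ T₁ ⊆ T, T₁.Finite ∧ SignedLE s (signedSSup s.flip T₁) (zeta A a)} :=
    { nonempty := by
        obtain ⟨a, ha⟩ := (isSignedFilter_setOf_le_zeta A s (signedSSup s.flip ∅)).nonempty
        exact ⟨a, ∅, Set.empty_subset T, Set.finite_empty, ha⟩
      inf_mem := fun ⟨T₁, hT₁, hT₁f, ha⟩ ⟨T₂, hT₂, hT₂f, hb⟩ =>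
        ⟨T₁ ∪ T₂, Set.union_subset hT₁ hT₂, hT₁f.union hT₂f,
          (isSignedFilter_setOf_le_zeta A s _).inf_mem
            ((signedSSup_flip_anti Set.subset_union_left).trans ha)
            ((signedSSup_flip_anti Set.subset_union_right).trans hb)⟩
      mem_of_le := fun hab ⟨T₁, hT₁, hT₁f, ha⟩ =>
        ⟨T₁, hT₁, hT₁f, ha.trans ((zeta_le_zeta_iff A).2 hab)⟩ }
  refine ⟨hfilter.toPoint, le_signedSSup_flip_iff.2 fun c hc => ?_, fun _ => hfilter.mem_toPoint.1⟩
  obtain ⟨t, rfl⟩ := (isSignedClosed_zeta_iff A).1 (hT c hc)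
  refine (point_le_point_iff A).2 fun a ha => hfilter.mem_toPoint.2 ?_
  exact ⟨_, Set.singleton_subset_iff.2 hc, Set.finite_singleton _,
    (signedSSup_flip_le (Set.mem_singleton _)).trans ((point_le_zeta_iff A).2 ha)⟩

theorem exists_finite_sInf_le_sSup {T U : Set (dualFrame A).Stable}
    (hT : ∀ c ∈ T, IsClosedElt (zeta A) c) (hU : ∀ c ∈ U, IsOpenElt (zeta A) c)
    (h : sInf T ≤ sSup U) :
    ∃ T₁ U₁, T₁ ⊆ T ∧ U₁ ⊆ U ∧ T₁.Finite ∧ U₁.Finite ∧ sInf T₁ ≤ sSup U₁ := by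
  obtain ⟨x, hxT, hx⟩ := exists_point_le_signedSSup A (s := Sgn.one) hT
  obtain ⟨y, hUy, hy⟩ := exists_point_le_signedSSup A (s := Sgn.del) hU
  have hxy : (dualFrame A).gal Sgn.one x y :=
    (dualFrame A).point_one_le_point_del_iff.1 (hxT.trans (h.trans hUy))
  obtain ⟨a, hax, hay⟩ := (gal_iff A).1 hxy
  obtain ⟨T₁, hT₁, hT₁f, hT₁a⟩ := hx a hax
  obtain ⟨U₁, hU₁, hU₁f, hU₁a⟩ := hy a hay
  exact ⟨T₁, U₁, hT₁, hU₁, hT₁f, hU₁f, le_trans hT₁a hU₁a⟩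

theorem isSignedClosed_point (z : (dualFrame A).Z s) :
    IsSignedClosed (zeta A) s ((dualFrame A).point s z) :=
  (isSignedClosed_zeta_iff A).2 ⟨z, rfl⟩

theorem isCanonicalExtension_zeta : IsCanonicalExtension (zeta A) where
  injective _ _ h := le_antisymm ((zeta_le_zeta_iff A (s := Sgn.one)).1 h.le)
    ((zeta_le_zeta_iff A (s := Sgn.one)).1 h.ge)
  map_sup := zeta_signedInf A Sgn.del
  map_inf := zeta_signedInf A Sgn.one
  map_bot := zeta_signedTop A Sgn.del
  map_top := zeta_signedTop A Sgn.one
  dense_inf B := ⟨_, Set.forall_mem_image.2 fun _ _ => isSignedClosed_point A (s := Sgn.del) _,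
    (dualFrame A).eq_signedSSup_point B Sgn.del⟩
  dense_sup B := ⟨_, Set.forall_mem_image.2 fun _ _ => isSignedClosed_point A (s := Sgn.one) _,
    (dualFrame A).eq_signedSSup_point B Sgn.one⟩
  compact _ _ hT hU := ⟨exists_finite_sInf_le_sSup A hT hU, fun ⟨_, _, hT₁, hU₁, _, _, h⟩ =>
    (sInf_le_sInf hT₁).trans (h.trans (sSup_le_sSup hU₁))⟩

end Zeta

section ComplexAlgebra

variable {B : (dualFrame A).Stable}

theorem complexOp_eq_signedSSup (j : J) (B : Fin (δ j).arity → (dualFrame A).Stable) :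
    (dualFrame A).complexOp j B = signedSSup (δ j).out
      ((fun p => (dualFrame A).point (δ j).out ((A.isNormalOp j).pointOp p)) ''
        {p | ∀ k, p k ∈ (dualFrame A).toSort (B k) ((δ j).inp k)}) := by
  have himage : (dualFrame A).image j (fun k => (dualFrame A).toSort (B k) ((δ j).inp k)) =
      ⋃ p ∈ {p | ∀ k, p k ∈ (dualFrame A).toSort (B k) ((δ j).inp k)},
        (dualFrame A).Gam _ ((A.isNormalOp j).pointOp p) := by
    ext z
    simp only [Set.mem_iUnion₂, exists_prop]
    exact exists_congr fun p => and_comm.trans (and_congr_right' (R_iff A))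
  rw [Frame.complexOp, himage, Frame.ofSort_biUnion]
  exact congrArg _ (Set.image_congr fun p _ => (dualFrame A).ofSort_Gam _ _)

theorem complexOp_zeta (j : J) (a : Fin (δ j).arity → L) :
    (dualFrame A).complexOp j (fun i => zeta A (a i)) = zeta A (A.op j a) := by
  rw [complexOp_eq_signedSSup]
  refine SignedLE.antisymm (s := (δ j).out) (signedSSup_le_iff.2 (Set.forall_mem_image.2 ?_)) ?_
  · exact fun p hp => (point_le_zeta_iff A).2
      (IsNormalOp.mem_pointOp.2 ⟨a, fun k => (mem_toSort_zeta A).1 (hp k), .refl _ _⟩)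
  · let principal := fun k => isSignedFilter_setOf_le ((δ j).inp k) (a k)
    refine SignedLE.trans ?_ (le_signedSSup (Set.mem_image_of_mem _
      (fun k => (mem_toSort_zeta A).2 ((principal k).mem_toPoint.2 (.refl _ (a k))))))
    refine (le_point_iff A).2 fun b hb => ?_
    obtain ⟨c, hc, hcb⟩ := IsNormalOp.mem_pointOp.1 hb
    have hac : SignedLE (δ j).out (A.op j a) (A.op j c) :=
      (A.isNormalOp j).mono fun k => (principal k).mem_toPoint.1 (hc k)
    exact (zeta_le_zeta_iff A).2 (hac.trans hcb)

theorem exists_closed_open_forall_dualMem {z : (dualFrame A).Z s}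
    (hz : z ∈ (dualFrame A).toSort B s) :
    ∃ k o, IsClosedElt (zeta A) k ∧ IsOpenElt (zeta A) o ∧ k ≤ B ∧ B ≤ o ∧
      ∀ a : L, k ≤ zeta A a → zeta A a ≤ o → dualMem a s z := by
  have hzeta (s : Sgn) (a : L) : IsSignedClosed (zeta A) s (zeta A a) :=
    zeta_eq_point A s a ▸ isSignedClosed_point A _
  have hzB := (dualFrame A).point_le_iff.2 hz
  have htop := zeta_signedTop A s ▸ le_signedBot_flip s B
  cases s
  · exact ⟨_, _, isSignedClosed_point A z, hzeta Sgn.del ⊤, hzB, htop,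
      fun _ ha _ => (point_le_zeta_iff A).1 ha⟩
  · exact ⟨_, _, hzeta Sgn.one ⊥, isSignedClosed_point A z, htop, hzB,
      fun _ _ ha => (point_le_zeta_iff A).1 ha⟩

theorem exists_mem_toSort_of_closed_le_open {k o : (dualFrame A).Stable}
    (hk : IsClosedElt (zeta A) k) (ho : IsOpenElt (zeta A) o) (hkB : k ≤ B) (hBo : B ≤ o)
    (s : Sgn) : ∃ z ∈ (dualFrame A).toSort B s, ∀ a : L, dualMem a s z →
      ∃ b : L, k ≤ zeta A b ∧ zeta A b ≤ o ∧ SignedLE s b a := by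
  obtain ⟨x, rfl⟩ := (isSignedClosed_zeta_iff A (s := Sgn.one)).1 hk
  obtain ⟨y, rfl⟩ := (isSignedClosed_zeta_iff A (s := Sgn.del)).1 ho
  have hx := isSignedFilter_dualMem (L := L) (s := Sgn.one) x
  have hy := isSignedFilter_dualMem (L := L) (s := Sgn.del) y
  obtain ⟨c, hcx, hcy⟩ := (gal_iff A).1
    ((dualFrame A).point_one_le_point_del_iff.1 (hkB.trans hBo))
  have hle {b : L} (hbx : dualMem b Sgn.one x) (hby : dualMem b Sgn.del y) :
      (dualFrame A).point Sgn.one x ≤ zeta A b ∧ zeta A b ≤ (dualFrame A).point Sgn.del y :=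
    ⟨(point_le_zeta_iff A (s := Sgn.one)).2 hbx, (point_le_zeta_iff A (s := Sgn.del)).2 hby⟩
  cases s
  · refine ⟨x, (dualFrame A).point_le_iff.1 hkB, fun a ha => ⟨a ⊓ c, ?_⟩⟩
    exact and_assoc.1 ⟨hle (hx.inf_mem ha hcx)
      (hy.mem_of_le inf_le_right hcy), inf_le_left⟩
  · refine ⟨y, (dualFrame A).point_le_iff.1 hBo, fun a ha => ⟨a ⊔ c, ?_⟩⟩
    exact and_assoc.1 ⟨hle (hx.mem_of_le le_sup_right hcx)
      (hy.inf_mem ha hcy), le_sup_left⟩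

theorem complexOp_eq_signedExt (j : J) :
    (dualFrame A).complexOp j = signedExt (δ j).out (zeta A) (A.op j) := by
  funext B
  rw [complexOp_eq_signedSSup, signedExt]
  refine SignedLE.antisymm (s := (δ j).out) (signedSSup_le_iff.2 ?_) (signedSSup_le_iff.2 ?_)
  · rintro _ ⟨p, hp, rfl⟩
    choose k o hk ho hkB hBo hko using fun i => exists_closed_open_forall_dualMem A (hp i)
    refine SignedLE.trans ?_ (le_signedSSup ⟨k, o, hk, ho, hkB, hBo, rfl⟩)
    refine le_signedSSup_flip_iff.2 ?_
    rintro _ ⟨a, hka, hao, rfl⟩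
    exact (point_le_zeta_iff A).2
      (IsNormalOp.mem_pointOp.2 ⟨a, fun i => hko i _ (hka i) (hao i), .refl _ _⟩)
  · rintro _ ⟨k, o, hk, ho, hkB, hBo, rfl⟩
    choose p hp hpko using fun i =>
      exists_mem_toSort_of_closed_le_open A (hk i) (ho i) (hkB i) (hBo i) ((δ j).inp i)
    refine SignedLE.trans ?_ (le_signedSSup (Set.mem_image_of_mem _ hp))
    refine (le_point_iff A).2 fun b hb => ?_
    obtain ⟨a, ha, hab⟩ := IsNormalOp.mem_pointOp.1 hb
    choose c hkc hco hca using fun i => hpko i (a i) (ha i)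
    have hcb : SignedLE (δ j).out (A.op j c) b := ((A.isNormalOp j).mono hca).trans hab
    exact SignedLE.trans (signedSSup_flip_le ⟨c, hkc, hco, rfl⟩) ((zeta_le_zeta_iff A).2 hcb)

theorem isCanonicalExtensionNLE_zeta :
    IsCanonicalExtensionNLE A (dualFrame A).complexOp (zeta A) where
  lattice := isCanonicalExtension_zeta A
  isNormalOp := (dualFrame A).isNormalOp_complexOp (smooth A)
  extends_op := complexOp_zeta A
  eq_sigmaExt j hj := by
    rw [complexOp_eq_signedExt, hj]
    rfl
  eq_piExt j hj := by
    rw [complexOp_eq_signedExt, hj]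
    rfl

end ComplexAlgebra

end dualFrame

namespace ImplicativeModalLattice

variable {L : Type u} [Lattice L] [BoundedOrder L] (M : ImplicativeModalLattice L)

theorem box_mono {a b : L} (hab : a ≤ b) : M.box a ≤ M.box b := by
  rw [← inf_eq_left, ← M.box_inf, inf_eq_left.2 hab]

theorem isSignedFilter_boxPreimage (x : dualPoint L Sgn.one) :
    IsSignedFilter Sgn.one {a | dualMem (M.box a) Sgn.one x} where
  nonempty := ⟨⊤, by
    rw [Set.mem_ofPred_eq, M.box_top]
    exact (isSignedFilter_dualMem x).top_mem⟩
  inf_mem {a b} ha hb := by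
    change dualMem (M.box (a ⊓ b)) Sgn.one x
    rw [M.box_inf]
    exact (isSignedFilter_dualMem x).inf_mem ha hb
  mem_of_le hab ha := (isSignedFilter_dualMem x).mem_of_le (M.box_mono hab) ha

/-- The filter `{a | □a ∈ x}`. -/
def boxPreimage (x : (dualFrame M.toNLE).Z Sgn.one) : (dualFrame M.toNLE).Z Sgn.one :=
  (M.isSignedFilter_boxPreimage x).toPoint

theorem isSignedFilter_boxImage (x : dualPoint L Sgn.one) :
    IsSignedFilter Sgn.one {b | ∃ a, dualMem a Sgn.one x ∧ M.box a ≤ b} where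
  nonempty := ⟨⊤, ⊤, (isSignedFilter_dualMem x).top_mem, le_top⟩
  inf_mem := fun ⟨_, ha, hab⟩ ⟨_, hc, hcd⟩ => ⟨_, (isSignedFilter_dualMem x).inf_mem ha hc,
    le_inf ((M.box_mono inf_le_left).trans hab) ((M.box_mono inf_le_right).trans hcd)⟩
  mem_of_le := fun hbc ⟨a, ha, hab⟩ => ⟨a, ha, le_trans hab hbc⟩

/-- The filter generated by `{□a | a ∈ x}`. -/
def boxImage (x : (dualFrame M.toNLE).Z Sgn.one) : (dualFrame M.toNLE).Z Sgn.one :=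
  (M.isSignedFilter_boxImage x).toPoint

theorem boxImage_le_iff {x z : (dualFrame M.toNLE).Z Sgn.one} :
    (dualFrame M.toNLE).le _ (M.boxImage x) z ↔ (dualFrame M.toNLE).le _ x (M.boxPreimage z) := by
  refine (dualFrame.le_iff _).trans (Iff.trans ?_ (dualFrame.le_iff _).symm)
  constructor
  · exact fun h a ha => h _ ⟨a, ha, le_rfl⟩
  · exact fun h b ⟨a, ha, hab⟩ =>
      (isSignedFilter_dualMem (L := L) (s := Sgn.one) z).mem_of_le hab (h a ha)

theorem boxDual_iff {x : (dualFrame M.toNLE).Z Sgn.one} {y : (dualFrame M.toNLE).Z Sgn.del} :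
    boxDual (dualFrame M.toNLE) x y ↔ (dualFrame M.toNLE).gal Sgn.one (M.boxPreimage x) y := by
  refine (dualFrame.Rdual_iff M.toNLE).trans (Iff.trans ?_ (dualFrame.gal_iff M.toNLE).symm)
  constructor
  · exact fun ⟨a, hay, hax⟩ => ⟨a (0 : Fin 1), hax, hay (0 : Fin 1)⟩
  · exact fun ⟨a, hax, hay⟩ => ⟨fun _ => a, fun _ => hay, hax⟩

theorem boxDoubleDual_eq_Gam (x : (dualFrame M.toNLE).Z Sgn.one) :
    boxDoubleDual (dualFrame M.toNLE) x = (dualFrame M.toNLE).Gam Sgn.one (M.boxPreimage x) := by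
  have hup : {y | boxDual (dualFrame M.toNLE) x y} =
      (dualFrame M.toNLE).up Sgn.one {M.boxPreimage x} :=
    Set.ext fun _ => M.boxDual_iff.trans ((dualFrame M.toNLE).mem_up_singleton).symm
  exact (congrArg _ hup).trans ((dualFrame M.toNLE).Gam_eq_cl _ _).symm

theorem mem_boxOp_iff {x : (dualFrame M.toNLE).Z Sgn.one} {B : (dualFrame M.toNLE).Stable} :
    x ∈ (boxOp (dualFrame M.toNLE) B).1 ↔ M.boxPreimage x ∈ B.1 := by
  let F := dualFrame M.toNLE
  have hpoints : (∀ p : Fin 1 → F.Z Sgn.del, (∀ i, p i ∈ F.up Sgn.one B.1) →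
      F.Rdual ModalIdx.box x p) ↔ ∀ y ∈ F.up Sgn.one B.1, boxDual F x y := by
    refine ⟨fun h y hy => h _ fun _ => hy, fun h p hp => ?_⟩
    rw [eq_const_of_unique p]
    exact h _ (hp 0)
  calc x ∈ (boxOp F B).1
      ↔ x ∈ F.down Sgn.one (F.image ModalIdx.box fun _ : Fin 1 => F.up Sgn.one B.1) :=
        Set.ext_iff.1 (F.ofSort_del_val _) x
    _ ↔ ∀ y ∈ F.up Sgn.one B.1, boxDual F x y :=
        (F.mem_up_image (j := ModalIdx.box) (t := x)).trans hpoints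
    _ ↔ M.boxPreimage x ∈ F.cl Sgn.one B.1 := forall₂_congr fun _ _ => M.boxDual_iff
    _ ↔ M.boxPreimage x ∈ B.1 := by rw [B.2]

theorem setOf_boxDoubleDual_subset_Gam (x : (dualFrame M.toNLE).Z Sgn.one) :
    {z | boxDoubleDual (dualFrame M.toNLE) z ⊆ (dualFrame M.toNLE).Gam Sgn.one x} =
      (dualFrame M.toNLE).Gam Sgn.one (M.boxImage x) := by
  ext z
  rw [Set.mem_ofPred_eq, boxDoubleDual_eq_Gam, Frame.Gam_subset_Gam_iff, ← boxImage_le_iff]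
  exact Iff.rfl

theorem boxOp_iSup_GamS_le (B : (dualFrame M.toNLE).Stable) :
    boxOp (dualFrame M.toNLE) (⨆ x ∈ B.1, (dualFrame M.toNLE).GamS x) ≤
      ⨆ x ∈ B.1, boxOp (dualFrame M.toNLE) ((dualFrame M.toNLE).GamS x) := by
  rw [Frame.iSup_GamS]
  intro x hx
  exact le_iSup₂ (f := fun z _ => boxOp (dualFrame M.toNLE) ((dualFrame M.toNLE).GamS z))
    (M.boxPreimage x) (M.mem_boxOp_iff.1 hx) (M.mem_boxOp_iff.2 Set.Subset.rfl)

theorem isRefinedFrame_dualFrame : IsRefinedFrame (dualFrame M.toNLE) where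
  separated := dualFrame.separated _
  increasing _ _ _ _ := dualFrame.R_of_le _
  decreasing _ _ _ _ _ := dualFrame.R_update_of_le _
  closed_section j p := ⟨_, dualFrame.setOf_R_eq_Gam _ j p⟩
  smooth := dualFrame.smooth _
  box_closed x := ⟨_, M.setOf_boxDoubleDual_subset_Gam x⟩
  box_iSup := M.boxOp_iSup_GamS_le

end ImplicativeModalLattice

theorem mainTheorem1 :
    (∀ {J : Type v} {δ : J → DistType} {L : Type u} [Lattice L] [BoundedOrder L] (A : NLE δ L),
      (dualFrame A).Separated ∧ (dualFrame A).Smooth ∧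
        IsCanonicalExtensionNLE A (dualFrame A).complexOp (zeta A)) ∧
    (∀ {L : Type u} [Lattice L] [BoundedOrder L] (M : ImplicativeModalLattice L),
      IsRefinedFrame (dualFrame M.toNLE)) :=
  ⟨fun A => ⟨dualFrame.separated A, dualFrame.smooth A, dualFrame.isCanonicalExtensionNLE_zeta A⟩,
    fun M => M.isRefinedFrame_dualFrame⟩
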